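/- For a real number $x>0$ let $\zeta(s,x)$ denote the Hurwitz zeta function, i.e. the analytic continuation to $s\in\mathbb{C}\setminus\{1\}$ of $\sum_{n=0}^{\infty}(n+x)^{-s}$ ($\operatorname{Re}s>1$), and write $\zeta'(s,x)=\frac{\partial}{\partial s}\zeta(s,x)$. For $y>0$ let $$\mathrm{Ci}(y)=-\int_y^{\infty}\frac{\cos t}{t}\,dt,\qquad \mathrm{Si}(y)=\int_0^{y}\frac{\sin t}{t}\,dt,\qquad \mathrm{si}(y)=\mathrm{Si}(y)-\frac{\pi}{2},$$ where the first integral is an improper integral, $\lim_{M\to\infty}\int_y^M$. Then for every real $x>0$ the series below converges absolutely and $$\zeta'(-1,x)=-\zeta(-1,x)\log x-\frac{x^2}{4}+\frac{1}{12}-\frac{1}{2\pi^2}\sum_{n=1}^{\infty}\frac{1}{n^2}\bigl[\cos(2n\pi x)\,\mathrm{Ci}(2n\pi x)+\sin(2n\pi x)\,\mathrm{si}(2n\pi x)\bigr].$$ -/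

import Mathlib

open Filter Topology Set

/-- The Hurwitz zeta function `ζ(s, x)` for a real parameter `x > 0`: the analytic continuation to
`s ≠ 1` of `∑ n ≥ 0, 1 / (n + x) ^ s`. Mathlib's `HurwitzZeta.hurwitzZeta` is 1-periodic in its
parameter and has the correct value for parameters in `(0, 1]`. Write `x = a + N` with
`a ∈ (0, 1]` and `N = ⌈x⌉₊ - 1`; then `ζ(s, x)` is `ζ(s, a)` without its first `N` terms.
The two lemmas below show that this is the analytic continuation of the series. -/
noncomputable def hurwitzZetaFun (s : ℂ) (x : ℝ) : ℂ :=
  HurwitzZeta.hurwitzZeta (x : UnitAddCircle) s -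
    ∑ k ∈ Finset.range (⌈x⌉₊ - 1), 1 / ((k : ℂ) + ((x - (⌈x⌉₊ - 1 : ℕ) : ℝ) : ℂ)) ^ s

lemma hurwitzZetaFun_sub_mem {x : ℝ} (hx : 0 < x) :
    0 < x - (⌈x⌉₊ - 1 : ℕ) ∧ x - (⌈x⌉₊ - 1 : ℕ) ≤ 1 := by
  have h1 : 1 ≤ ⌈x⌉₊ := Nat.one_le_ceil_iff.mpr hx
  have h2 := Nat.ceil_lt_add_one hx.le
  have h3 := Nat.le_ceil x
  push_cast [Nat.cast_sub h1]
  constructor <;> linarith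

lemma hasSum_hurwitzZetaFun {x : ℝ} (hx : 0 < x) {s : ℂ} (hs : 1 < s.re) :
    HasSum (fun n : ℕ => 1 / ((n : ℂ) + (x : ℂ)) ^ s) (hurwitzZetaFun s x) := by
  obtain ⟨h0, h1⟩ := hurwitzZetaFun_sub_mem hx
  have hper : ((x - (⌈x⌉₊ - 1 : ℕ) : ℝ) : UnitAddCircle) = (x : UnitAddCircle) := by
    rw [AddCircle.coe_sub, sub_eq_self, AddCircle.coe_eq_zero_iff]
    exact ⟨(⌈x⌉₊ - 1 : ℕ), by simp⟩
  have h := HurwitzZeta.hasSum_hurwitzZeta_of_one_lt_re (Set.mem_Icc.mpr ⟨h0.le, h1⟩) hs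
  rw [hper] at h
  have h' := (hasSum_nat_add_iff' (⌈x⌉₊ - 1)).mpr h
  refine h'.congr_fun fun n => ?_
  congr 2
  push_cast
  ring

lemma differentiableAt_hurwitzZetaFun {x : ℝ} (hx : 0 < x) {s : ℂ} (hs : s ≠ 1) :
    DifferentiableAt ℂ (fun s => hurwitzZetaFun s x) s := by
  obtain ⟨h0, -⟩ := hurwitzZetaFun_sub_mem hx
  unfold hurwitzZetaFun
  refine (HurwitzZeta.differentiableAt_hurwitzZeta _ hs).sub
    (DifferentiableAt.fun_sum fun k _ => ?_)
  have hne : (k : ℂ) + ((x - (⌈x⌉₊ - 1 : ℕ) : ℝ) : ℂ) ≠ 0 := by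
    have : (0 : ℝ) < k + (x - (⌈x⌉₊ - 1 : ℕ)) := by positivity
    exact_mod_cast this.ne'
  refine (differentiableAt_const _).div (differentiableAt_id.const_cpow (Or.inl hne)) ?_
  exact fun h => hne ((Complex.cpow_eq_zero_iff _ _).mp h).1

/-- The sine integral `Si(x) = ∫_0^x (sin t) / t dt`. -/
noncomputable def sinInt (x : ℝ) : ℝ := ∫ t in (0 : ℝ)..x, Real.sin t / t

/-- The shifted sine integral `si(x) = Si(x) - π / 2`. -/
noncomputable def sinIntShifted (x : ℝ) : ℝ := sinInt x - Real.pi / 2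

/-- The cosine integral `Ci(x) = -∫_x^∞ (cos t) / t dt` for `x > 0`. The integral is only
conditionally convergent: it is the limit of `∫_x^M` as `M → ∞`, which exists by the lemma
`tendsto_cosInt`. -/
noncomputable def cosInt (x : ℝ) : ℝ :=
  -limUnder atTop (fun M : ℝ => ∫ t in x..M, Real.cos t / t)

lemma tendsto_cosInt {x : ℝ} (hx : 0 < x) :
    Tendsto (fun M : ℝ => ∫ t in x..M, Real.cos t / t) atTop (𝓝 (-cosInt x)) := by
  rw [cosInt, neg_neg]
  apply tendsto_nhds_limUnder
  have hint : MeasureTheory.IntegrableOn (fun t : ℝ => Real.sin t * (-(t ^ 2)⁻¹)) (Ioi x) := by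
    have h2 : MeasureTheory.IntegrableOn (fun t : ℝ => t ^ (-2 : ℝ)) (Ioi x) :=
      integrableOn_Ioi_rpow_of_lt (by norm_num) hx
    refine h2.mono' (by fun_prop) ?_
    refine (MeasureTheory.ae_restrict_iff' measurableSet_Ioi).mpr (Eventually.of_forall fun t ht => ?_)
    have ht0 : 0 < t := hx.trans ht
    have e : t ^ (-2 : ℝ) = (t ^ 2)⁻¹ := by
      rw [Real.rpow_neg ht0.le]; norm_cast
    rw [e, norm_mul, norm_neg, Real.norm_eq_abs, Real.norm_eq_abs, abs_of_pos (a := (t ^ 2)⁻¹)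
      (by positivity)]
    exact mul_le_of_le_one_left (by positivity) (Real.abs_sin_le_one t)
  have hlim := MeasureTheory.intervalIntegral_tendsto_integral_Ioi x hint tendsto_id
  have hbd : Tendsto (fun M : ℝ => Real.sin M * M⁻¹) atTop (𝓝 0) := by
    refine squeeze_zero_norm' ?_ tendsto_inv_atTop_zero
    filter_upwards [eventually_gt_atTop 0] with M hM
    rw [norm_mul, Real.norm_eq_abs, Real.norm_eq_abs, abs_of_pos (inv_pos.mpr hM)]
    exact mul_le_of_le_one_left (by positivity) (Real.abs_sin_le_one M)
  refine ⟨_, ((hbd.sub_const (Real.sin x * x⁻¹)).sub hlim).congr' ?_⟩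
  filter_upwards [eventually_ge_atTop x] with M hM
  have hpos : ∀ t ∈ uIcc x M, t ≠ 0 := fun t ht => by
    rw [uIcc_of_le hM] at ht
    exact (hx.trans_le ht.1).ne'
  have key := intervalIntegral.integral_mul_deriv_eq_deriv_mul (a := x) (b := M)
    (u := fun t : ℝ => t⁻¹) (u' := fun t => -(t ^ 2)⁻¹) (v := Real.sin) (v' := Real.cos)
    (fun t ht => hasDerivAt_inv (hpos t ht)) (fun t _ => Real.hasDerivAt_sin t)
    (ContinuousOn.intervalIntegrable (by
      refine ContinuousOn.neg (ContinuousOn.inv₀ (by fun_prop) fun t ht => ?_)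
      exact pow_ne_zero 2 (hpos t ht)))
    (Real.continuous_cos.intervalIntegrable _ _)
  simp only [div_eq_inv_mul, id]
  rw [key]
  simp only [mul_comm]

/-! Third-order Euler–Maclaurin writes `ζ(s, x)` as elementary terms minus `s(s+1)(s+2)/6` times
`R(s) = ∫_x^∞ B₃({u-x}) u^(-s-3) du`. Since `B₃` of the fractional part is bounded, `R` is analytic
for `re s > -2`, a region containing `-1`, and the formula continues there. The prefactor vanishes
at `-1` with derivative `-1/6`, so only the value `R(-1) = ∫_x^∞ B₃({u-x}) u⁻² du` enters the
derivative, never `R'(-1)`.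

The Fourier series of `B₃` turns `R(-1)` into a sum of integrals of `sin(a(u-x)) u⁻²`, `a = 2πn`.
One integration by parts (`integral_sin_mul_sq_inv`) expresses each through `Ci` and `si`; this
needs the Dirichlet integral, to identify `-si` with a tail integral. -/

/-! ### The Dirichlet integral -/

-- Integrating the absolute value over `y` leaves `|sinc t|`, which is continuous. This licenses the
-- Fubini swap behind the Dirichlet integral.
open MeasureTheory in
lemma integrable_exp_neg_mul_mul_sin_prod (M : ℝ) :
    Integrable (Function.uncurry fun t y : ℝ => Real.exp (-t * y) * Real.sin t)
      ((volume.restrict (Ioc 0 M)).prod (volume.restrict (Ioi 0))) := by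
  have hmeas : AEStronglyMeasurable
      (Function.uncurry fun t y : ℝ => Real.exp (-t * y) * Real.sin t)
      ((volume.restrict (Ioc 0 M)).prod (volume.restrict (Ioi 0))) := by
    apply Continuous.aestronglyMeasurable
    simp only [Function.uncurry_def]
    fun_prop
  rw [integrable_prod_iff hmeas]
  constructor
  · filter_upwards [ae_restrict_mem measurableSet_Ioc] with t ht
    exact (integrableOn_exp_mul_Ioi (neg_lt_zero.mpr ht.1) 0).mul_const (Real.sin t)
  · have hcont : Integrable (fun t : ℝ => |Real.sinc t|) (volume.restrict (Ioc 0 M)) :=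
      (Real.continuous_sinc.abs.integrableOn_Icc (a := 0) (b := M)).mono_set Ioc_subset_Icc_self
    refine hcont.congr ?_
    filter_upwards [ae_restrict_mem measurableSet_Ioc] with t ht
    simp only [Function.uncurry_apply_pair, norm_mul, Real.norm_eq_abs, Real.abs_exp]
    rw [integral_mul_const, integral_exp_mul_Ioi (neg_lt_zero.mpr ht.1),
      Real.sinc_of_ne_zero ht.1.ne', abs_div, abs_of_pos ht.1]
    simp
    ring

lemma integral_exp_neg_mul_mul_sin (M y : ℝ) :
    ∫ t in (0 : ℝ)..M, Real.exp (-t * y) * Real.sin t =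
      (1 + y ^ 2)⁻¹ - Real.exp (-M * y) * (Real.cos M + y * Real.sin M) / (1 + y ^ 2) := by
  have hne : 1 + y ^ 2 ≠ 0 := by positivity
  have hder : ∀ t ∈ uIcc 0 M, HasDerivAt
      (fun t => -(Real.exp (-t * y) * (Real.cos t + y * Real.sin t)) / (1 + y ^ 2))
      (Real.exp (-t * y) * Real.sin t) t := by
    intro t _
    have h1 : HasDerivAt (fun t => Real.exp (-t * y)) (Real.exp (-t * y) * (-1 * y)) t :=
      ((hasDerivAt_id t).neg.mul_const y).exp
    have h2 : HasDerivAt (fun t => Real.cos t + y * Real.sin t)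
        (-Real.sin t + y * Real.cos t) t :=
      (Real.hasDerivAt_cos t).add ((Real.hasDerivAt_sin t).const_mul y)
    refine ((h1.mul h2).neg.div_const (1 + y ^ 2)).congr_deriv ?_
    field_simp
    ring
  rw [intervalIntegral.integral_eq_sub_of_hasDerivAt hder
    (Continuous.intervalIntegrable (by fun_prop) _ _)]
  simp
  ring

-- Substituting `1/t = ∫_0^∞ e^(-ty) dy` in `Si(M)` and swapping integrals gives `∫_0^∞ dy/(1+y²) =
-- π/2` minus an integral dominated by that of `2e^(-My)`.
open MeasureTheory in
lemma norm_sinIntShifted_le {M : ℝ} (hM : 0 < M) : ‖sinIntShifted M‖ ≤ 2 / M := by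
  have hswap := integral_integral_swap (integrable_exp_neg_mul_mul_sin_prod M)
  have hleft : ∫ t in Ioc 0 M, ∫ y in Ioi (0 : ℝ), Real.exp (-t * y) * Real.sin t = sinInt M := by
    rw [sinInt, intervalIntegral.integral_of_le hM.le]
    refine setIntegral_congr_fun measurableSet_Ioc fun t ht => ?_
    rw [integral_mul_const, integral_exp_mul_Ioi (neg_lt_zero.mpr ht.1)]
    simp
    ring
  rw [hleft] at hswap
  simp_rw [← intervalIntegral.integral_of_le hM.le, integral_exp_neg_mul_mul_sin] at hswap
  have hexp : IntegrableOn (fun y => 2 * Real.exp (-M * y)) (Ioi 0) :=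
    (integrableOn_exp_mul_Ioi (neg_lt_zero.mpr hM) 0).const_mul 2
  have hbound : ∀ y ∈ Ioi (0 : ℝ),
      ‖Real.exp (-M * y) * (Real.cos M + y * Real.sin M) / (1 + y ^ 2)‖
        ≤ 2 * Real.exp (-M * y) := by
    intro y hy
    have hpos : 0 < 1 + y ^ 2 := by positivity
    rw [norm_div, Real.norm_of_nonneg hpos.le, div_le_iff₀ hpos, norm_mul,
      Real.norm_of_nonneg (Real.exp_nonneg _)]
    have h1 : ‖Real.cos M + y * Real.sin M‖ ≤ 1 + y := by
      refine (norm_add_le _ _).trans (add_le_add (Real.abs_cos_le_one M) ?_)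
      rw [norm_mul, Real.norm_of_nonneg (le_of_lt hy)]
      exact mul_le_of_le_one_right (le_of_lt hy) (Real.abs_sin_le_one M)
    have h2 : 1 + y ≤ 2 * (1 + y ^ 2) := by nlinarith [sq_nonneg (y - 1)]
    nlinarith [Real.exp_pos (-M * y)]
  have hcont : Continuous fun y : ℝ =>
      Real.exp (-M * y) * (Real.cos M + y * Real.sin M) / (1 + y ^ 2) :=
    Continuous.div (by fun_prop) (by fun_prop) fun y => by positivity
  have hae := (ae_restrict_iff' (μ := volume) measurableSet_Ioi).mpr (Eventually.of_forall hbound)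
  have hint := Integrable.mono' hexp hcont.aestronglyMeasurable hae
  rw [integral_sub integrable_inv_one_add_sq.integrableOn hint, integral_Ioi_inv_one_add_sq,
    Real.arctan_zero, sub_zero] at hswap
  rw [sinIntShifted, hswap, sub_sub_cancel_left, norm_neg]
  refine (norm_integral_le_of_norm_le hexp hae).trans_eq ?_
  rw [integral_const_mul, integral_exp_mul_Ioi (neg_lt_zero.mpr hM)]
  simp
  ring

lemma intervalIntegrable_sin_div (a b : ℝ) :
    IntervalIntegrable (fun t => Real.sin t / t) MeasureTheory.volume a b := by
  refine (Real.continuous_sinc.intervalIntegrable a b).congr_ae ?_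
  refine MeasureTheory.ae_restrict_of_ae ?_
  filter_upwards [MeasureTheory.Measure.ae_ne MeasureTheory.volume (0 : ℝ)] with t ht
  exact Real.sinc_of_ne_zero ht

/-- The Dirichlet integral: `∫_x^∞ (sin t) / t dt = -si(x)`. -/
lemma tendsto_integral_sin_div (x : ℝ) :
    Tendsto (fun M : ℝ => ∫ t in x..M, Real.sin t / t) atTop (𝓝 (-sinIntShifted x)) := by
  have h0 : Tendsto sinIntShifted atTop (𝓝 0) := by
    refine squeeze_zero_norm' ?_ (tendsto_const_nhds.div_atTop tendsto_id : Tendsto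
      (fun M : ℝ => 2 / M) atTop (𝓝 0))
    filter_upwards [eventually_gt_atTop 0] with M hM using norm_sinIntShifted_le hM
  have h := h0.sub_const (sinIntShifted x)
  rw [zero_sub] at h
  refine h.congr fun M => ?_
  rw [sinIntShifted, sinIntShifted, sub_sub_sub_cancel_right, sinInt, sinInt,
    intervalIntegral.integral_interval_sub_left (intervalIntegrable_sin_div _ _)
      (intervalIntegrable_sin_div _ _)]

/-! ### Sine integrals against `u⁻²` -/

open MeasureTheory in
lemma integrableOn_Ioi_sq_inv {x : ℝ} (hx : 0 < x) :
    IntegrableOn (fun u : ℝ => (u ^ 2)⁻¹) (Ioi x) := by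
  refine (integrableOn_Ioi_rpow_of_lt (a := -2) (by norm_num) hx).congr_fun (fun u hu => ?_)
    measurableSet_Ioi
  simp only
  rw [Real.rpow_neg (hx.trans hu).le]
  norm_cast

open MeasureTheory in
lemma integral_Ioi_sq_inv {x : ℝ} (hx : 0 < x) : ∫ u in Ioi x, (u ^ 2)⁻¹ = x⁻¹ := by
  have h := integral_Ioi_rpow_of_lt (a := -2) (by norm_num) hx
  norm_num [Real.rpow_neg_one] at h
  exact h

open MeasureTheory in
lemma integrableOn_Ioi_mul_sq_inv {x C : ℝ} (hx : 0 < x) {f : ℝ → ℝ} (hf : Measurable f)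
    (hC : ∀ u, ‖f u‖ ≤ C) : IntegrableOn (fun u : ℝ => f u * (u ^ 2)⁻¹) (Ioi x) :=
  (integrableOn_Ioi_sq_inv hx).bdd_mul hf.aestronglyMeasurable (Eventually.of_forall hC)

open MeasureTheory in
lemma norm_integral_sin_mul_sq_inv_le {x : ℝ} (hx : 0 < x) (a : ℝ) :
    ∫ u in Ioi x, ‖Real.sin (a * (u - x)) * (u ^ 2)⁻¹‖ ≤ x⁻¹ := by
  rw [← integral_Ioi_sq_inv hx]
  have hi := integrableOn_Ioi_mul_sq_inv (C := 1) hx (f := fun u => Real.sin (a * (u - x)))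
    (by fun_prop) fun u => Real.abs_sin_le_one _
  refine integral_mono hi.norm (integrableOn_Ioi_sq_inv hx) fun u => ?_
  simp only [norm_mul]
  rw [Real.norm_of_nonneg (inv_nonneg.mpr (sq_nonneg u))]
  exact mul_le_of_le_one_left (by positivity) (Real.abs_sin_le_one _)

-- Integration by parts gives `a ∫ cos(a(u-x))/u du`: the boundary term is zero at `u = x` and tends
-- to zero at infinity. Expanding the cosine and rescaling `t = au` produces the tails defining `Ci`
-- and `-si`.
open MeasureTheory in
lemma integral_sin_mul_sq_inv {x a : ℝ} (hx : 0 < x) (ha : 0 < a) :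
    ∫ u in Ioi x, Real.sin (a * (u - x)) * (u ^ 2)⁻¹ =
      -a * (Real.cos (a * x) * cosInt (a * x) + Real.sin (a * x) * sinIntShifted (a * x)) := by
  have hi := integrableOn_Ioi_mul_sq_inv (C := 1) hx (f := fun u => Real.sin (a * (u - x)))
    (by fun_prop) fun u => Real.abs_sin_le_one _
  refine tendsto_nhds_unique (intervalIntegral_tendsto_integral_Ioi x hi tendsto_id) ?_
  have hscale : Tendsto (fun M : ℝ => a * M) atTop atTop := tendsto_id.const_mul_atTop ha
  have hc := ((tendsto_cosInt (mul_pos ha hx)).comp hscale).const_mul (Real.cos (a * x))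
  have hs := ((tendsto_integral_sin_div (a * x)).comp hscale).const_mul (Real.sin (a * x))
  have hbd : Tendsto (fun M : ℝ => Real.sin (a * (M - x)) * M⁻¹) atTop (𝓝 0) := by
    refine squeeze_zero_norm' ?_ tendsto_inv_atTop_zero
    filter_upwards [eventually_gt_atTop 0] with M hM
    rw [norm_mul, Real.norm_eq_abs, Real.norm_of_nonneg (inv_pos.mpr hM).le]
    exact mul_le_of_le_one_left (by positivity) (Real.abs_sin_le_one _)
  have hlim := ((hc.add hs).const_mul a).sub hbd
  have e : a * (Real.cos (a * x) * -cosInt (a * x) + Real.sin (a * x) * -sinIntShifted (a * x)) - 0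
    = -a * (Real.cos (a * x) * cosInt (a * x) + Real.sin (a * x) * sinIntShifted (a * x)) := by
    ring
  rw [e] at hlim
  refine hlim.congr' ?_
  filter_upwards [eventually_ge_atTop x] with M hM
  have hpos : ∀ t ∈ uIcc x M, t ≠ 0 := fun t ht => by
    rw [uIcc_of_le hM] at ht
    exact (hx.trans_le ht.1).ne'
  have hinv : ContinuousOn (fun t : ℝ => t⁻¹) (uIcc x M) := continuousOn_id.inv₀ hpos
  have hsub : ∀ f : ℝ → ℝ, ∫ t in a * x..a * M, f t / t = ∫ u in x..M, f (a * u) * u⁻¹ := by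
    intro f
    rw [← intervalIntegral.mul_integral_comp_mul_left, ← intervalIntegral.integral_const_mul]
    refine intervalIntegral.integral_congr fun u hu => ?_
    have := hpos u hu
    field_simp
  have key := intervalIntegral.integral_mul_deriv_eq_deriv_mul (a := x) (b := M)
    (u := fun t : ℝ => Real.sin (a * (t - x))) (u' := fun t => Real.cos (a * (t - x)) * (a * 1))
    (v := fun t : ℝ => -t⁻¹) (v' := fun t => -(-(t ^ 2)⁻¹))
    (fun t ht => (((hasDerivAt_id t).sub_const x).const_mul a).sin)
    (fun t ht => (hasDerivAt_inv (hpos t ht)).neg)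
    (Continuous.intervalIntegrable (by fun_prop) _ _)
    (ContinuousOn.intervalIntegrable (by
      refine ContinuousOn.neg (ContinuousOn.neg (ContinuousOn.inv₀ (by fun_prop) fun t ht => ?_))
      exact pow_ne_zero 2 (hpos t ht)))
  simp only [neg_neg, id] at key ⊢
  rw [key]
  simp only [Function.comp_apply]
  rw [hsub, hsub, ← intervalIntegral.integral_const_mul, ← intervalIntegral.integral_const_mul,
    ← intervalIntegral.integral_add
      (ContinuousOn.intervalIntegrable (by fun_prop)) (ContinuousOn.intervalIntegrable (by fun_prop)),
    ← intervalIntegral.integral_const_mul]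
  have hcongr : ∫ u in x..M, a * (Real.cos (a * x) * (Real.cos (a * u) * u⁻¹) +
      Real.sin (a * x) * (Real.sin (a * u) * u⁻¹)) =
      -∫ u in x..M, Real.cos (a * (u - x)) * (a * 1) * -u⁻¹ := by
    rw [← intervalIntegral.integral_neg]
    refine intervalIntegral.integral_congr fun u _ => ?_
    simp only [mul_sub, Real.cos_sub]
    ring
  rw [hcongr]
  simp
  ring

/-! ### The Fourier series of `B₃` and termwise integration -/

lemma bernoulliFun_three (v : ℝ) : bernoulliFun 3 v = v ^ 3 - 3 / 2 * v ^ 2 + v / 2 := by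
  simp [bernoulliFun, Polynomial.bernoulli_def, Finset.sum_range_succ, bernoulli_eq_bernoulli'_of_ne_one]
  norm_num [Nat.choose]
  ring

lemma hasSum_sin_bernoulliFun_three (v : ℝ) :
    HasSum (fun n : ℕ => 1 / ((n : ℝ) + 1) ^ 3 * Real.sin (2 * (n + 1) * Real.pi * v))
      (2 * Real.pi ^ 3 / 3 * bernoulliFun 3 (Int.fract v)) := by
  have h := hasSum_one_div_nat_pow_mul_sin one_ne_zero
    (x := Int.fract v) ⟨Int.fract_nonneg v, (Int.fract_lt_one v).le⟩
  -- The dropped term `n = 0` is zero, as `sin 0 = 0`.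
  rw [← hasSum_nat_add_iff' 1] at h
  convert! h using 1
  · ext n
    push_cast
    congr 1
    rw [Int.fract, mul_sub, show 2 * Real.pi * ((n : ℝ) + 1) * (⌊v⌋ : ℝ) =
      (((n + 1) * ⌊v⌋ : ℤ) : ℝ) * (2 * Real.pi) by push_cast; ring, Real.sin_sub_int_mul_two_pi]
    ring_nf
  · rw [bernoulliFun]
    simp [Nat.factorial, -mul_eq_mul_right_iff]
    ring

lemma abs_bernoulliFun_three_fract_le (v : ℝ) : ‖bernoulliFun 3 (Int.fract v)‖ ≤ 1 := by
  have h0 := Int.fract_nonneg v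
  have h1 := (Int.fract_lt_one v).le
  rw [bernoulliFun_three, Real.norm_eq_abs, abs_le]
  constructor <;> nlinarith [mul_nonneg h0 (sub_nonneg.mpr h1), mul_nonneg h0 h0,
    mul_nonneg (mul_nonneg h0 h0) (sub_nonneg.mpr h1), mul_nonneg (mul_nonneg h0 h0) h0]

lemma measurable_bernoulliFun_fract (k : ℕ) (x : ℝ) :
    Measurable fun u : ℝ => bernoulliFun k (Int.fract (u - x)) :=
  (continuous_bernoulliFun k).measurable.comp (measurable_fract.comp (measurable_sub_const x))

-- Termwise integration is legitimate because the `L¹` norms are at most `(n+1)⁻³ x⁻¹`.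
open MeasureTheory in
lemma hasSum_cosInt_sinIntShifted {x : ℝ} (hx : 0 < x) :
    HasSum (fun n : ℕ => 1 / ((n : ℝ) + 1) ^ 2 *
      (Real.cos (2 * (n + 1) * Real.pi * x) * cosInt (2 * (n + 1) * Real.pi * x) +
        Real.sin (2 * (n + 1) * Real.pi * x) * sinIntShifted (2 * (n + 1) * Real.pi * x)))
      (-(Real.pi ^ 2 / 3) * ∫ u in Ioi x, bernoulliFun 3 (Int.fract (u - x)) * (u ^ 2)⁻¹) := by
  have hint : ∀ n : ℕ, IntegrableOn (fun u => 1 / ((n : ℝ) + 1) ^ 3 *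
      (Real.sin (2 * (n + 1) * Real.pi * (u - x)) * (u ^ 2)⁻¹)) (Ioi x) := fun n =>
    (integrableOn_Ioi_mul_sq_inv (C := 1) hx
      (f := fun u => Real.sin (2 * (n + 1) * Real.pi * (u - x)))
      (by fun_prop) fun u => Real.abs_sin_le_one _).const_mul _
  have hnorm : ∀ n : ℕ, ∫ u in Ioi x, ‖1 / ((n : ℝ) + 1) ^ 3 *
      (Real.sin (2 * (n + 1) * Real.pi * (u - x)) * (u ^ 2)⁻¹)‖ ≤ 1 / ((n : ℝ) + 1) ^ 3 * x⁻¹ := by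
    intro n
    have hp : 0 ≤ 1 / ((n : ℝ) + 1) ^ 3 := by positivity
    simp_rw [norm_mul (1 / ((n : ℝ) + 1) ^ 3), Real.norm_of_nonneg hp]
    rw [integral_const_mul]
    exact mul_le_mul_of_nonneg_left (norm_integral_sin_mul_sq_inv_le hx _) hp
  have hsummable : Summable fun n : ℕ => 1 / ((n : ℝ) + 1) ^ 3 * x⁻¹ := by
    have := (summable_nat_add_iff 1).mpr (Real.summable_one_div_nat_pow.mpr (by norm_num : 1 < 3))
    push_cast at this
    exact this.mul_right _
  have h := hasSum_integral_of_summable_integral_norm hint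
    (Summable.of_nonneg_of_le (fun n => integral_nonneg fun u => norm_nonneg _) hnorm hsummable)
  have hts : ∀ u : ℝ, ∑' n : ℕ, 1 / ((n : ℝ) + 1) ^ 3 *
      (Real.sin (2 * (n + 1) * Real.pi * (u - x)) * (u ^ 2)⁻¹) =
      2 * Real.pi ^ 3 / 3 * (bernoulliFun 3 (Int.fract (u - x)) * (u ^ 2)⁻¹) := by
    intro u
    rw [← mul_assoc, ← ((hasSum_sin_bernoulliFun_three (u - x)).mul_right _).tsum_eq]
    simp_rw [mul_assoc]
  simp_rw [hts] at h
  rw [integral_const_mul] at h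
  -- The factor `-a = -2π(n+1)` from each sine integral lowers the cube to a square; the rescaling
  -- removes the remaining `-2π`.
  convert! h.mul_left (-(1 / (2 * Real.pi))) using 1
  · ext n
    rw [integral_const_mul, integral_sin_mul_sq_inv hx (by positivity)]
    have := Real.pi_pos
    field_simp
  · have := Real.pi_pos
    field_simp

/-! ### The Euler–Maclaurin formula -/

/-- The main terms of the third order Euler–Maclaurin formula for `∑ (n + x) ^ (-s)`. -/
noncomputable def hurwitzZetaMain (s : ℂ) (u : ℝ) : ℂ :=
  (u : ℂ) ^ (1 - s) / (s - 1) + (u : ℂ) ^ (-s) / 2 + s * (u : ℂ) ^ (-s - 1) / 12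

/-- The remainder integral of the third order Euler–Maclaurin formula for `∑ (n + x) ^ (-s)`. -/
noncomputable def hurwitzZetaRemainder (s : ℂ) (x : ℝ) : ℂ :=
  ∫ u in Ioi x, (bernoulliFun 3 (Int.fract (u - x)) : ℂ) * (u : ℂ) ^ (-s - 3)

/-- One Euler–Maclaurin step. At the endpoints `B₃` vanishes, `B₂` equals `1/6` and `B₁` equals
`∓1/2`; the sign change of `B₁` produces the extra `a^(-s)`. -/
lemma integral_bernoulliFun_three_mul_cpow {a : ℝ} (ha : 0 < a) {s : ℂ} (hs : s ≠ 1) :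
    s * (s + 1) * (s + 2) / 6 * ∫ u in a..a + 1, (bernoulliFun 3 (u - a) : ℂ) * (u : ℂ) ^ (-s - 3) =
      hurwitzZetaMain s a - hurwitzZetaMain s (a + 1) - (a : ℂ) ^ (-s) := by
  have hpos : ∀ u ∈ uIcc a (a + 1), 0 < u := fun u hu => by
    rw [uIcc_of_le (by linarith)] at hu
    exact ha.trans_le hu.1
  have hs1 : s - 1 ≠ 0 := sub_ne_zero.mpr hs
  -- Antiderivative from repeated integration by parts with `B_k' = k B_{k-1}`: the polynomials are
  -- `B₃`, `B₂`, `B₁` at `z - a`.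
  let G : ℂ → ℂ := fun z =>
    -(((z - a) ^ 3 - 3 / 2 * (z - a) ^ 2 + (z - a) / 2) * (s * (s + 1) / 6) * z ^ (-s - 2) +
      ((z - a) ^ 2 - (z - a) + 6⁻¹) * (s / 2) * z ^ (-s - 1) + ((z - a) - 1 / 2) * z ^ (-s) +
      z ^ (1 - s) / (s - 1))
  have hder : ∀ u ∈ uIcc a (a + 1), HasDerivAt (fun u : ℝ => G u)
      (s * (s + 1) * (s + 2) / 6 * ((bernoulliFun 3 (u - a) : ℂ) * (u : ℂ) ^ (-s - 3))) u := by
    intro u hu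
    have hu0 := hpos u hu
    have hz : (u : ℂ) ≠ 0 := by exact_mod_cast hu0.ne'
    have hsl : (u : ℂ) ∈ Complex.slitPlane := Complex.ofReal_mem_slitPlane.mpr hu0
    have hc : ∀ c : ℂ, HasDerivAt (fun z : ℂ => z ^ c) (c * (u : ℂ) ^ (c - 1) * 1) (u : ℂ) :=
      fun c => (hasDerivAt_id (u : ℂ)).cpow_const hsl
    have hd : HasDerivAt (fun z : ℂ => z - a) 1 (u : ℂ) := (hasDerivAt_id _).sub_const _
    have h3 := (((hd.pow 3).sub ((hd.pow 2).const_mul (3 / 2))).add (hd.div_const 2)).mul_const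
      (s * (s + 1) / 6)
    have h2 := (((hd.pow 2).sub hd).add_const (6⁻¹ : ℂ)).mul_const (s / 2)
    have h1 := hd.sub_const (1 / 2 : ℂ)
    have hG := ((((h3.mul (hc (-s - 2))).add (h2.mul (hc (-s - 1)))).add (h1.mul (hc (-s)))).add
      ((hc (1 - s)).div_const (s - 1))).neg
    have hG' := hG.comp_ofReal
    refine HasDerivAt.congr_deriv (f := fun u : ℝ => G u) hG' ?_
    have e3 : (-s - 2 - 1 : ℂ) = -s - 3 := by ring
    have p2 : (u : ℂ) ^ (-s - 2) = (u : ℂ) ^ (-s - 3) * u := by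
      rw [show -s - 2 = -s - 3 + 1 by ring, Complex.cpow_add _ _ hz, Complex.cpow_one]
    have p1 : (u : ℂ) ^ (-s - 1) = (u : ℂ) ^ (-s - 3) * u ^ 2 := by
      rw [show -s - 1 = -s - 3 + (2 : ℕ) by push_cast; ring, Complex.cpow_add _ _ hz,
        Complex.cpow_natCast]
    have p0 : (u : ℂ) ^ (-s) = (u : ℂ) ^ (-s - 3) * u ^ 3 := by
      rw [show -s = -s - 3 + (3 : ℕ) by push_cast; ring, Complex.cpow_add _ _ hz,
        Complex.cpow_natCast]
      ring_nf
    rw [show (1 - s - 1 : ℂ) = -s by ring, show (-s - 1 - 1 : ℂ) = -s - 2 by ring, e3, p2, p1, p0,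
      bernoulliFun_three]
    push_cast
    simp only [Pi.pow_apply, Pi.sub_apply, Pi.add_apply]
    field_simp
    ring
  have hcont : ContinuousOn (fun u : ℝ => s * (s + 1) * (s + 2) / 6 *
      ((bernoulliFun 3 (u - a) : ℂ) * (u : ℂ) ^ (-s - 3))) (uIcc a (a + 1)) := by
    refine continuousOn_const.mul (ContinuousOn.mul ?_ ?_)
    · exact (Complex.continuous_ofReal.comp
        ((continuous_bernoulliFun 3).comp (continuous_sub_right a))).continuousOn
    · exact fun u hu => (Complex.continuousAt_ofReal_cpow_const _ _
        (Or.inr (hpos u hu).ne')).continuousWithinAt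
  rw [← intervalIntegral.integral_const_mul,
    intervalIntegral.integral_eq_sub_of_hasDerivAt hder hcont.intervalIntegrable]
  simp only [G, hurwitzZetaMain]
  push_cast
  ring

open MeasureTheory in
lemma integrableOn_bernoulliFun_fract_mul_cpow {x : ℝ} (hx : 0 < x) {s : ℂ} (hs : -2 < s.re) :
    IntegrableOn (fun u : ℝ => (bernoulliFun 3 (Int.fract (u - x)) : ℂ) * (u : ℂ) ^ (-s - 3))
      (Ioi x) := by
  refine (integrableOn_Ioi_cpow_of_lt (a := -s - 3) (by simp; linarith) hx).bdd_mul (c := 1)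
    (Complex.measurable_ofReal.comp
      (measurable_bernoulliFun_fract 3 x)).aestronglyMeasurable (Eventually.of_forall fun u => ?_)
  rw [Complex.norm_real]
  exact abs_bernoulliFun_three_fract_le _

open MeasureTheory in
lemma integral_bernoulliFun_fract_mul_cpow {x : ℝ} (hx : 0 < x) {s : ℂ} (hs : s ≠ 1)
    (hs2 : -2 < s.re) (N : ℕ) :
    s * (s + 1) * (s + 2) / 6 *
      ∫ u in x..x + N, (bernoulliFun 3 (Int.fract (u - x)) : ℂ) * (u : ℂ) ^ (-s - 3) =
      hurwitzZetaMain s x - hurwitzZetaMain s (x + N) -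
        ∑ n ∈ Finset.range N, 1 / ((n : ℂ) + (x : ℂ)) ^ s := by
  have hint := integrableOn_bernoulliFun_fract_mul_cpow hx hs2
  induction N with
  | zero => simp
  | succ N ih =>
    have hxN : x ≤ x + N := by simp
    have hsub : ∀ a b : ℝ, x ≤ a → a ≤ b → IntervalIntegrable (fun u : ℝ =>
        (bernoulliFun 3 (Int.fract (u - x)) : ℂ) * (u : ℂ) ^ (-s - 3)) volume a b :=
      fun a b ha hab => (intervalIntegrable_iff_integrableOn_Ioc_of_le hab).mpr
        (hint.mono_set fun u hu => ha.trans_lt hu.1)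
    have hunit : ∫ u in x + N..x + N + 1,
        (bernoulliFun 3 (Int.fract (u - x)) : ℂ) * (u : ℂ) ^ (-s - 3) =
        ∫ u in x + N..x + N + 1, (bernoulliFun 3 (u - (x + N)) : ℂ) * (u : ℂ) ^ (-s - 3) := by
      -- Open intervals avoid the right endpoint, where the fractional part jumps.
      rw [intervalIntegral.integral_of_le (by linarith), intervalIntegral.integral_of_le
        (by linarith), integral_Ioc_eq_integral_Ioo, integral_Ioc_eq_integral_Ioo]
      refine setIntegral_congr_fun measurableSet_Ioo fun u hu => ?_
      have hfl : Int.fract (u - x) = u - (x + N) := by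
        rw [Int.fract_eq_iff]
        exact ⟨by linarith [hu.1], by linarith [hu.2], N, by push_cast; ring⟩
      simp only [hfl]
    have hterm : 1 / ((N : ℂ) + (x : ℂ)) ^ s = ((x + N : ℝ) : ℂ) ^ (-s) := by
      rw [Complex.cpow_neg, one_div]
      push_cast
      rw [add_comm]
    have hN : x + ((N + 1 : ℕ) : ℝ) = x + N + 1 := by push_cast; ring
    rw [hN, ← intervalIntegral.integral_add_adjacent_intervals (hsub _ _ le_rfl hxN)
      (hsub _ _ hxN (by linarith)), mul_add, ih, hunit,
      integral_bernoulliFun_three_mul_cpow (hx.trans_le hxN) hs, Finset.sum_range_succ, hterm]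
    ring

lemma tendsto_ofReal_cpow_atTop_zero {c : ℂ} (hc : c.re < 0) :
    Tendsto (fun u : ℝ => (u : ℂ) ^ c) atTop (𝓝 0) := by
  have h := tendsto_rpow_neg_atTop (neg_pos.mpr hc)
  rw [neg_neg] at h
  refine squeeze_zero_norm' ?_ h
  filter_upwards [eventually_gt_atTop 0] with u hu
  rw [Complex.norm_cpow_eq_rpow_re_of_pos hu]

lemma tendsto_hurwitzZetaMain_atTop_zero {s : ℂ} (hs : 1 < s.re) :
    Tendsto (hurwitzZetaMain s) atTop (𝓝 0) := by
  have h1 := (tendsto_ofReal_cpow_atTop_zero (c := 1 - s) (by simp; linarith)).div_const (s - 1)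
  have h2 := (tendsto_ofReal_cpow_atTop_zero (c := -s) (by simp; linarith)).div_const 2
  have h3 := ((tendsto_ofReal_cpow_atTop_zero (c := -s - 1) (by simp; linarith)).const_mul
    s).div_const 12
  simpa [hurwitzZetaMain] using! (h1.add h2).add h3

/-- The Euler–Maclaurin formula in the half plane of convergence. -/
lemma hurwitzZetaFun_eq_of_one_lt_re {x : ℝ} (hx : 0 < x) {s : ℂ} (hs : 1 < s.re) :
    hurwitzZetaFun s x =
      hurwitzZetaMain s x - s * (s + 1) * (s + 2) / 6 * hurwitzZetaRemainder s x := by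
  have hs1 : s ≠ 1 := by rintro rfl; simp at hs
  have hs2 : -2 < s.re := by linarith
  have hN : Tendsto (fun N : ℕ => x + (N : ℝ)) atTop atTop :=
    tendsto_atTop_add_const_left _ _ tendsto_natCast_atTop_atTop
  have h1 := (MeasureTheory.intervalIntegral_tendsto_integral_Ioi x
    (integrableOn_bernoulliFun_fract_mul_cpow hx hs2) hN).const_mul (s * (s + 1) * (s + 2) / 6)
  simp_rw [integral_bernoulliFun_fract_mul_cpow hx hs1 hs2] at h1
  have h2 := (((tendsto_hurwitzZetaMain_atTop_zero hs).comp hN).const_sub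
    (hurwitzZetaMain s x)).sub (hasSum_hurwitzZetaFun hx hs).tendsto_sum_nat
  rw [hurwitzZetaRemainder, tendsto_nhds_unique h1 h2]
  ring

/-! ### Analytic continuation in `s` -/

lemma hurwitzZetaRemainder_eq_mellin {x : ℝ} (hx : 0 < x) (s : ℂ) :
    hurwitzZetaRemainder s x = mellin
      ((Ioi x).indicator fun u : ℝ => (bernoulliFun 3 (Int.fract (u - x)) : ℂ)) (-s - 2) := by
  have hsub : Ioi x ⊆ Ioi 0 := Ioi_subset_Ioi hx.le
  rw [mellin, hurwitzZetaRemainder]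
  nth_rw 1 [← inter_eq_self_of_subset_right hsub]
  rw [← MeasureTheory.setIntegral_indicator measurableSet_Ioi]
  refine MeasureTheory.setIntegral_congr_fun measurableSet_Ioi fun u _ => ?_
  simp only [indicator, smul_eq_mul, mul_ite, mul_zero]
  rw [show -s - 2 - 1 = -s - 3 by ring, mul_comm]

lemma differentiableAt_hurwitzZetaRemainder {x : ℝ} (hx : 0 < x) {s : ℂ} (hs : -2 < s.re) :
    DifferentiableAt ℂ (fun s => hurwitzZetaRemainder s x) s := by
  simp_rw [hurwitzZetaRemainder_eq_mellin hx]
  set f : ℝ → ℂ := (Ioi x).indicator fun u => (bernoulliFun 3 (Int.fract (u - x)) : ℂ) with hf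
  have hbd : ∀ u, ‖f u‖ ≤ 1 := fun u => by
    refine (norm_indicator_le_norm_self _ _).trans ?_
    rw [Complex.norm_real]
    exact abs_bernoulliFun_three_fract_le _
  have hmeas : Measurable f :=
    (Complex.measurable_ofReal.comp (measurable_bernoulliFun_fract 3 x)).indicator measurableSet_Ioi
  have hloc : MeasureTheory.LocallyIntegrableOn f (Ioi 0) :=
    ((MeasureTheory.locallyIntegrable_const (1 : ℝ)).mono hmeas.aestronglyMeasurable
      (Eventually.of_forall fun u => by simpa using hbd u)).locallyIntegrableOn _
  have htop : f =O[atTop] (fun u : ℝ => u ^ (-(0 : ℝ))) :=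
    Asymptotics.IsBigO.of_bound 1 (Eventually.of_forall fun u => by simpa using hbd u)
  -- As `f` vanishes near `0`, any exponent would do; this one lies below `re(-s-2)` as required.
  have hbot : f =O[𝓝[>] 0] (fun u : ℝ => u ^ (-((-s - 2).re - 1))) := by
    refine Asymptotics.IsBigO.of_bound 1 ?_
    filter_upwards [mem_nhdsWithin_of_mem_nhds (Iio_mem_nhds hx)] with u hu
    rw [hf, indicator_of_notMem (by simpa using le_of_lt hu), norm_zero]
    positivity
  have hm := mellin_differentiableAt_of_isBigO_rpow (s := -s - 2) hloc htop
    (by simp; linarith) hbot (by simp)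
  exact DifferentiableAt.comp (g := mellin f) (f := fun s : ℂ => -s - 2) s hm (by fun_prop)

lemma differentiableAt_hurwitzZetaMain {x : ℝ} (hx : 0 < x) {s : ℂ} (hs : s ≠ 1) :
    DifferentiableAt ℂ (fun s => hurwitzZetaMain s x) s := by
  have hne : (x : ℂ) ≠ 0 := by exact_mod_cast hx.ne'
  have h1 : DifferentiableAt ℂ (fun s => (x : ℂ) ^ (1 - s)) s :=
    DifferentiableAt.const_cpow (by fun_prop) (Or.inl hne)
  have h2 : DifferentiableAt ℂ (fun s => (x : ℂ) ^ (-s)) s :=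
    DifferentiableAt.const_cpow (by fun_prop) (Or.inl hne)
  have h3 : DifferentiableAt ℂ (fun s => (x : ℂ) ^ (-s - 1)) s :=
    DifferentiableAt.const_cpow (by fun_prop) (Or.inl hne)
  have h4 : DifferentiableAt ℂ (fun s : ℂ => s - 1) s := by fun_prop
  unfold hurwitzZetaMain
  exact ((h1.fun_div h4 (sub_ne_zero.mpr hs)).fun_add (h2.div_const 2)).fun_add
    ((differentiableAt_fun_id.fun_mul h3).div_const 12)

/-- The Euler–Maclaurin formula in the strip `-2 < re s < 1`, by analytic continuation. -/
lemma hurwitzZetaFun_eq_of_re_lt_one {x : ℝ} (hx : 0 < x) {s : ℂ} (hs2 : -2 < s.re)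
    (hs1 : s.re < 1) :
    hurwitzZetaFun s x =
      hurwitzZetaMain s x - s * (s + 1) * (s + 2) / 6 * hurwitzZetaRemainder s x := by
  -- The regions `A` and `C` are disjoint; `B` joins them through the upper half plane, avoiding the
  -- pole at `1`.
  let A : Set ℂ := {z | -2 < z.re} ∩ {z | z.re < 1}
  let B : Set ℂ := {z | -2 < z.re} ∩ {z | 0 < z.im}
  let C : Set ℂ := {z | 1 < z.re}
  have hA : IsPreconnected A :=
    ((convex_halfSpace_re_gt _).inter (convex_halfSpace_re_lt _)).isPreconnected
  have hB : IsPreconnected B :=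
    ((convex_halfSpace_re_gt _).inter (convex_halfSpace_im_gt _)).isPreconnected
  have hC : IsPreconnected C := (convex_halfSpace_re_gt _).isPreconnected
  have hU : IsPreconnected ((A ∪ B) ∪ C) := by
    refine IsPreconnected.union (2 + Complex.I) (Or.inr ?_) ?_
      (IsPreconnected.union Complex.I ?_ ?_ hA hB) hC <;> norm_num [A, B, C]
  have hAo : IsOpen A :=
    (isOpen_lt continuous_const Complex.continuous_re).inter
      (isOpen_lt Complex.continuous_re continuous_const)
  have hBo : IsOpen B :=
    (isOpen_lt continuous_const Complex.continuous_re).inter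
      (isOpen_lt continuous_const Complex.continuous_im)
  have hCo : IsOpen C := isOpen_lt continuous_const Complex.continuous_re
  have hUo : IsOpen ((A ∪ B) ∪ C) := (hAo.union hBo).union hCo
  have hUs : ∀ z ∈ (A ∪ B) ∪ C, z ≠ 1 ∧ -2 < z.re := by
    rintro z ((hz | hz) | hz)
    · exact ⟨by rintro rfl; simp [A] at hz, hz.1⟩
    · exact ⟨by rintro rfl; simp [B] at hz, hz.1⟩
    · exact ⟨by rintro rfl; simp [C] at hz, by simp only [C, mem_ofPred_eq] at hz; linarith⟩
  have hf : AnalyticOnNhd ℂ (fun s => hurwitzZetaFun s x) ((A ∪ B) ∪ C) :=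
    DifferentiableOn.analyticOnNhd (fun z hz =>
      (differentiableAt_hurwitzZetaFun hx (hUs z hz).1).differentiableWithinAt) hUo
  have hg : AnalyticOnNhd ℂ (fun s => hurwitzZetaMain s x -
      s * (s + 1) * (s + 2) / 6 * hurwitzZetaRemainder s x) ((A ∪ B) ∪ C) :=
    DifferentiableOn.analyticOnNhd (fun z hz =>
      ((differentiableAt_hurwitzZetaMain hx (hUs z hz).1).sub
        (DifferentiableAt.mul (by fun_prop)
          (differentiableAt_hurwitzZetaRemainder hx (hUs z hz).2))).differentiableWithinAt) hUo
  have h2 : (2 : ℂ) ∈ C := by norm_num [C]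
  refine hf.eqOn_of_preconnected_of_eventuallyEq hg hU (Or.inr h2) ?_ (Or.inl (Or.inl ⟨hs2, hs1⟩))
  filter_upwards [hCo.mem_nhds h2] with z hz using hurwitzZetaFun_eq_of_one_lt_re hx hz

/-! ### Value and derivative at `s = -1` -/

lemma hurwitzZetaFun_neg_one {x : ℝ} (hx : 0 < x) :
    hurwitzZetaFun (-1) x = -(x : ℂ) ^ 2 / 2 + x / 2 - 1 / 12 := by
  rw [hurwitzZetaFun_eq_of_re_lt_one hx (by norm_num) (by norm_num), hurwitzZetaMain]
  norm_num
  ring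

lemma hasDerivAt_hurwitzZetaMain_neg_one {x : ℝ} (hx : 0 < x) :
    HasDerivAt (fun s => hurwitzZetaMain s x)
      (((x : ℂ) ^ 2 / 2 - x / 2 + 1 / 12) * Real.log x - (x : ℂ) ^ 2 / 4 + 1 / 12) (-1) := by
  have hne : (x : ℂ) ≠ 0 := by exact_mod_cast hx.ne'
  have hid : HasDerivAt (fun s : ℂ => s) 1 (-1) := hasDerivAt_id _
  have h1 := ((hid.const_sub 1).const_cpow (c := (x : ℂ)) (Or.inl hne)).div (hid.sub_const 1)
    (by norm_num)
  have h2 := (hid.neg.const_cpow (c := (x : ℂ)) (Or.inl hne)).div_const 2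
  have h3 := (hid.mul ((hid.neg.sub_const 1).const_cpow (c := (x : ℂ)) (Or.inl hne))).div_const 12
  refine ((h1.add h2).add h3).congr_deriv ?_
  rw [Complex.ofReal_log hx.le]
  norm_num
  ring

lemma hurwitzZetaRemainder_neg_one (x : ℝ) :
    hurwitzZetaRemainder (-1) x =
      ((∫ u in Ioi x, bernoulliFun 3 (Int.fract (u - x)) * (u ^ 2)⁻¹ : ℝ) : ℂ) := by
  rw [hurwitzZetaRemainder, ← integral_complex_ofReal]
  refine MeasureTheory.setIntegral_congr_fun measurableSet_Ioi fun u _ => ?_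
  rw [show (-(-1) - 3 : ℂ) = -(2 : ℕ) by norm_num, Complex.cpow_neg, Complex.cpow_natCast]
  push_cast
  rfl

theorem mainTheorem9 (x : ℝ) (hx : 0 < x) :
    Summable (fun n : ℕ => 1 / ((n : ℝ) + 1) ^ 2 *
      (Real.cos (2 * (n + 1) * Real.pi * x) * cosInt (2 * (n + 1) * Real.pi * x) +
        Real.sin (2 * (n + 1) * Real.pi * x) * sinIntShifted (2 * (n + 1) * Real.pi * x))) ∧
    HasDerivAt (fun s : ℂ => hurwitzZetaFun s x)
      (-hurwitzZetaFun (-1) x * (Real.log x : ℂ) - (x : ℂ) ^ 2 / 4 + 1 / 12 -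
        1 / (2 * (Real.pi : ℂ) ^ 2) *
          ((∑' n : ℕ, 1 / ((n : ℝ) + 1) ^ 2 *
            (Real.cos (2 * (n + 1) * Real.pi * x) * cosInt (2 * (n + 1) * Real.pi * x) +
              Real.sin (2 * (n + 1) * Real.pi * x) *
                sinIntShifted (2 * (n + 1) * Real.pi * x)) : ℝ) : ℂ))
      (-1) := by
  have h := hasSum_cosInt_sinIntShifted hx
  refine ⟨h.summable, ?_⟩
  rw [h.tsum_eq]
  have hev : (fun s : ℂ => hurwitzZetaFun s x) =ᶠ[𝓝 (-1)] fun s =>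
      hurwitzZetaMain s x - s * (s + 1) * (s + 2) / 6 * hurwitzZetaRemainder s x := by
    have hopen : IsOpen ({z : ℂ | -2 < z.re} ∩ {z | z.re < 1}) :=
      (isOpen_lt continuous_const Complex.continuous_re).inter
        (isOpen_lt Complex.continuous_re continuous_const)
    filter_upwards [hopen.mem_nhds (by norm_num : (-1 : ℂ) ∈ _)] with z hz using
      hurwitzZetaFun_eq_of_re_lt_one hx hz.1 hz.2
  have hid : HasDerivAt (fun s : ℂ => s) 1 (-1) := hasDerivAt_id _
  have hR := (differentiableAt_hurwitzZetaRemainder hx (s := -1) (by norm_num)).hasDerivAt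
  -- The unknown derivative of the remainder is multiplied by `s + 1 = 0` and drops out.
  have hd := (hasDerivAt_hurwitzZetaMain_neg_one hx).sub
    ((((hid.mul (hid.add_const 1)).mul (hid.add_const 2)).div_const 6).mul hR)
  refine HasDerivAt.congr_of_eventuallyEq (hd.congr_deriv ?_) hev
  rw [hurwitzZetaFun_neg_one hx, hurwitzZetaRemainder_neg_one x]
  have hpi : (Real.pi : ℂ) ≠ 0 := by exact_mod_cast Real.pi_ne_zero
  simp only [Pi.mul_apply]
  push_cast
  field_simp
  ring
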